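/- Let $K$ be a commutative field with a derivation $\delta : K \to K$ (an additive map with $\delta(ab) = a\,\delta(b) + \delta(a)\,b$), let $F = \{a \in K : \delta(a) = 0\}$ be its subfield of constants, and assume that $K/F$ is a finite extension. Let $\mathcal A^+ = K[X; \mathrm{id}_K, \delta]$ be the ring of Ore polynomials, that is, polynomials in $X$ over $K$ with the usual addition and with the multiplication determined by $Xa = aX + \delta(a)$ for $a \in K$. Let $Z(X) = \sum_i z_i X^i$ be the monic polynomial of minimal degree over $K$ that annihilates $\delta$, i.e. such that $\sum_i z_i \delta^i = 0$ as a map $K \to K$; it is a central element of $\mathcal A^+$. Let $z \in F$ and put $N = Z(X) - z$, which is central in $\mathcal A^+$. Then there exists a ring isomorphism $$\varphi : \varprojlim_{m > 0} \mathcal A^+/N^m\mathcal A^+ \;\stackrel{\sim}{\longrightarrow}\; (\mathcal A^+/N\mathcal A^+)[[T]]$$ (where $T$ commutes with the coefficients) that is an isomorphism of $K$-algebras, i.e. it maps the image of each $a \in K$ in the source to the image of $a$ in the target (as a constant series), that sends $N$ to $T$, and that induces the identity of $\mathcal A^+/N\mathcal A^+$ modulo $N$ on the left and modulo $T$ on the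 right: for every $f$ in the inverse limit, the constant coefficient of $\varphi(f)$ is the image of $f$ in $\mathcal A^+/N\mathcal A^+$. -/

import Mathlib

noncomputable section

/-! ### Differential Ore polynomials -/

namespace DiffOre

open Polynomial

/-- The subfield `F` of constants of a derivation `δ` of a field `K`. -/
def constants {K : Type*} [Field K] (δ : Derivation ℤ K K) : Subfield K where
  carrier := {a | δ a = 0}
  mul_mem' {a b} ha hb := by
    simp only [Set.mem_ofPred_eq] at *
    simp [ha, hb]
  one_mem' := by simp
  add_mem' {a b} ha hb := by
    simp only [Set.mem_ofPred_eq] at *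
    simp [ha, hb]
  zero_mem' := by simp
  neg_mem' {a} ha := by
    simp only [Set.mem_ofPred_eq] at *
    simp [ha]
  inv_mem' a ha := by
    simp only [Set.mem_ofPred_eq] at *
    by_cases h : a = 0
    · simp [h]
    · have h1 : δ (a * a⁻¹) = 0 := by rw [mul_inv_cancel₀ h]; simp
      rw [Derivation.leibniz, ha, smul_zero, add_zero, smul_eq_mul] at h1
      exact (mul_eq_zero.1 h1).resolve_left h

/-- For an additive endomorphism `u` of a `K`-vector space `M` and `P = ∑ aᵢ Xⁱ`, the additive
endomorphism `P(u) = ∑ aᵢ uⁱ` of `M`. -/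
def evalEnd {K M : Type*} [Field K] [AddCommGroup M] [Module K M] (u : AddMonoid.End M) :
    K[X] →+ AddMonoid.End M where
  toFun P := P.eval₂ (Module.toAddMonoidEnd K M) u
  map_zero' := eval₂_zero _ _
  map_add' _ _ := eval₂_add _ _

theorem evalEnd_monomial {K M : Type*} [Field K] [AddCommGroup M] [Module K M]
    (u : AddMonoid.End M) (n : ℕ) (a : K) :
    evalEnd u (monomial n a) = Module.toAddMonoidEnd K M a * u ^ n :=
  eval₂_monomial _ _

/-- The underlying type of the Ore polynomial ring `K[X; id, δ]`: polynomials in `X` over `K`,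
with coefficients written on the left. It carries the usual addition and, below, the twisted
multiplication such that `X a = a X + δ(a)` for `a ∈ K`. -/
def OrePoly {K : Type*} [Field K] (_δ : Derivation ℤ K K) : Type _ := K[X]

section

variable {K : Type*} [Field K] {δ : Derivation ℤ K K}

instance : AddCommGroup (OrePoly δ) := inferInstanceAs (AddCommGroup K[X])

/-- The Ore polynomial `∑ aᵢ Xⁱ` with the same coefficients as a given polynomial. -/
def ofPoly (δ : Derivation ℤ K K) : K[X] ≃+ OrePoly δ := AddEquiv.refl _

/-- The action of `δ` on polynomials coefficientwise. -/
def mapCoeff (δ : Derivation ℤ K K) : AddMonoid.End K[X] where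
  toFun P := P.sum fun n a => monomial n (δ a)
  map_zero' := by simp
  map_add' P Q := by
    apply sum_add_index <;> simp

theorem mapCoeff_monomial (n : ℕ) (a : K) :
    mapCoeff δ (monomial n a) = monomial n (δ a) := by
  exact sum_monomial_index a (fun n a => monomial n (δ a)) (by simp)

/-- Left multiplication by `X` in `K[X; id, δ]`:
`X · ∑ bⱼ Xʲ = ∑ (bⱼ Xʲ⁺¹ + δ(bⱼ) Xʲ)`. -/
def mulX (δ : Derivation ℤ K K) : AddMonoid.End K[X] :=
  AddMonoid.End.mulLeft (X : K[X]) + mapCoeff δ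

theorem mulX_monomial (n : ℕ) (a : K) :
    mulX δ (monomial n a) = monomial (n + 1) a + monomial n (δ a) := by
  change X * monomial n a + mapCoeff δ (monomial n a) = _
  rw [mapCoeff_monomial, X_mul_monomial]

/-- `(∑ aᵢ Xⁱ) · Q = ∑ aᵢ (Xⁱ · Q)`, where `Xⁱ · Q` is the `i`-fold left multiplication by `X`. -/
instance : Mul (OrePoly δ) where
  mul P Q := ofPoly δ (evalEnd (mulX δ) ((ofPoly δ).symm P) ((ofPoly δ).symm Q))

instance : One (OrePoly δ) where
  one := ofPoly δ 1

theorem mul_def (P Q : K[X]) :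
    ofPoly δ P * ofPoly δ Q = ofPoly δ (evalEnd (mulX δ) P Q) := rfl

theorem one_def : (1 : OrePoly δ) = ofPoly δ 1 := rfl

/-- The rule `u ∘ a = a u + δ(a)` for a pseudo-linear endomorphism. -/
theorem mulX_comm (a : K) :
    mulX δ * Module.toAddMonoidEnd K K[X] a =
      Module.toAddMonoidEnd K K[X] a * mulX δ + Module.toAddMonoidEnd K K[X] (δ a) := by
  apply Polynomial.addHom_ext
  intro n b
  change mulX δ (a • monomial n b) = a • mulX δ (monomial n b) + δ a • monomial n b
  rw [smul_monomial, mulX_monomial, mulX_monomial, smul_add, smul_monomial, smul_monomial,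
    smul_monomial, add_assoc, ← map_add]
  simp [mul_comm]

theorem evalEnd_smul {M : Type*} [AddCommGroup M] [Module K M] (u : AddMonoid.End M)
    (a : K) (P : K[X]) :
    evalEnd u (a • P) = Module.toAddMonoidEnd K M a * evalEnd u P := by
  induction P using Polynomial.induction_on' with
  | add p q hp hq => rw [smul_add, map_add, map_add, hp, hq, mul_add]
  | monomial n b => rw [smul_monomial, evalEnd_monomial, evalEnd_monomial, smul_eq_mul, map_mul,
      mul_assoc]

/-- Evaluation at a pseudo-linear endomorphism turns left multiplication by `X` into
composition. -/
theorem evalEnd_mulX {M : Type*} [AddCommGroup M] [Module K M] (u : AddMonoid.End M)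
    (hu : ∀ a : K, u * Module.toAddMonoidEnd K M a =
      Module.toAddMonoidEnd K M a * u + Module.toAddMonoidEnd K M (δ a)) (P : K[X]) :
    evalEnd u (mulX δ P) = u * evalEnd u P := by
  induction P using Polynomial.induction_on' with
  | add p q hp hq => rw [map_add, map_add, map_add, hp, hq, mul_add]
  | monomial n b =>
    rw [mulX_monomial, map_add, evalEnd_monomial, evalEnd_monomial, evalEnd_monomial,
      ← mul_assoc, hu, add_mul, pow_succ', ← mul_assoc]

theorem evalEnd_mul {M : Type*} [AddCommGroup M] [Module K M] (u : AddMonoid.End M)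
    (hu : ∀ a : K, u * Module.toAddMonoidEnd K M a =
      Module.toAddMonoidEnd K M a * u + Module.toAddMonoidEnd K M (δ a)) (P Q : K[X]) :
    evalEnd u (evalEnd (mulX δ) P Q) = evalEnd u P * evalEnd u Q := by
  induction P using Polynomial.induction_on' with
  | add p q hp hq =>
    rw [map_add, map_add, add_mul, ← hp, ← hq]
    exact map_add (evalEnd u) _ _
  | monomial n b =>
    rw [evalEnd_monomial, evalEnd_monomial]
    change evalEnd u (b • ((mulX δ) ^ n) Q) = _
    rw [evalEnd_smul, mul_assoc]
    congr 1
    induction n with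
    | zero => rw [pow_zero, pow_zero, one_mul]; rfl
    | succ n ih =>
      rw [pow_succ', pow_succ', mul_assoc, ← ih]
      exact evalEnd_mulX u hu _

theorem evalEnd_one {M : Type*} [AddCommGroup M] [Module K M] (u : AddMonoid.End M) :
    evalEnd (K := K) u 1 = 1 := by
  rw [← monomial_zero_one, evalEnd_monomial, pow_zero, map_one, one_mul]

theorem mulX_pow_monomial (i : ℕ) : ((mulX δ) ^ i) 1 = monomial i 1 := by
  induction i with
  | zero => rfl
  | succ n ih =>
    rw [pow_succ']
    change mulX δ (((mulX δ) ^ n) 1) = _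
    rw [ih, mulX_monomial]
    simp

/-- The Ore polynomial ring `K[X; id, δ]`. -/
instance : Ring (OrePoly δ) :=
  { (inferInstance : AddCommGroup (OrePoly δ)), (inferInstance : Mul (OrePoly δ)),
    (inferInstance : One (OrePoly δ)) with
    left_distrib := fun P Q R => map_add (evalEnd (mulX δ) P) Q R
    right_distrib := fun P Q R =>
      DFunLike.congr_fun (map_add (evalEnd (mulX δ)) P Q) R
    zero_mul := fun P => DFunLike.congr_fun (map_zero (evalEnd (mulX δ))) P
    mul_zero := fun P => map_zero (evalEnd (mulX δ) P)
    mul_assoc := fun P Q R =>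
      DFunLike.congr_fun (evalEnd_mul (mulX δ) mulX_comm P Q) R
    one_mul := fun P => DFunLike.congr_fun (evalEnd_one (mulX δ)) P
    mul_one := fun P => by
      change evalEnd (mulX δ) P (1 : K[X]) = (P : K[X])
      generalize (P : K[X]) = P
      induction P using Polynomial.induction_on' with
      | add p q hp hq =>
        rw [map_add]
        change evalEnd (mulX δ) p 1 + evalEnd (mulX δ) q 1 = p + q
        rw [hp, hq]
      | monomial n b =>
        rw [evalEnd_monomial]
        change b • ((mulX δ) ^ n) 1 = _
        rw [mulX_pow_monomial, smul_monomial, smul_eq_mul, mul_one] }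

/-- The inclusion of `K` into `K[X; id, δ]` as constant polynomials, which gives
`K[X; id, δ]` its `K`-algebra structure (`K` is not central when `δ ≠ 0`). -/
def const (δ : Derivation ℤ K K) : K →+* OrePoly δ where
  toFun a := ofPoly δ (C a)
  map_zero' := by simp
  map_one' := by simp [one_def]
  map_add' a b := by simp
  map_mul' a b := by
    rw [mul_def, ← monomial_zero_left, ← monomial_zero_left, evalEnd_monomial,
      ← smul_eq_mul, ← smul_monomial]
    rfl

/-- The variable `X` of `K[X; id, δ]`. -/
def var (δ : Derivation ℤ K K) : OrePoly δ := ofPoly δ X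

theorem const_mul (a : K) (P : K[X]) : const δ a * ofPoly δ P = ofPoly δ (a • P) := by
  change ofPoly δ (evalEnd (mulX δ) (C a) P) = _
  rw [← monomial_zero_left, evalEnd_monomial]
  rfl

theorem var_mul (P : K[X]) : var δ * ofPoly δ P = ofPoly δ (mulX δ P) := by
  change ofPoly δ (evalEnd (mulX δ) X P) = _
  rw [← monomial_one_one_eq_X, evalEnd_monomial, pow_one, map_one, one_mul]

/-- The defining relation `X a = a X + δ(a)`. -/
theorem var_mul_const (a : K) : var δ * const δ a = const δ a * var δ + const δ (δ a) := by
  change var δ * ofPoly δ (C a) = const δ a * ofPoly δ X + ofPoly δ (C (δ a))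
  rw [var_mul, const_mul, ← map_add, ← monomial_zero_left, mulX_monomial, zero_add,
    ← monomial_one_one_eq_X, smul_monomial]
  simp

/-- The Ore polynomial with coefficients `aᵢ` is `∑ aᵢ Xⁱ`, computed in `K[X; id, δ]`. -/
theorem ofPoly_eq_sum (P : K[X]) :
    ofPoly δ P = P.sum fun i a => const δ a * var δ ^ i := by
  have hX : ∀ i : ℕ, var δ ^ i = ofPoly δ (monomial i 1) := by
    intro i
    induction i with
    | zero => rfl
    | succ n ih => rw [pow_succ', ih, var_mul, mulX_monomial]; simp
  conv_lhs => rw [← Polynomial.sum_monomial_eq P]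
  simp only [Polynomial.sum, map_sum]
  refine Finset.sum_congr rfl fun i _ => ?_
  rw [hX, const_mul, smul_monomial, smul_eq_mul, mul_one]

theorem mem_center_of_commute (P : OrePoly δ) (hX : Commute P (var δ))
    (hK : ∀ a, Commute P (const δ a)) : P ∈ Subring.center (OrePoly δ) := by
  rw [Subring.mem_center_iff]
  intro Q
  obtain ⟨Q, rfl⟩ := (ofPoly δ).surjective Q
  rw [ofPoly_eq_sum]
  refine Commute.eq (Commute.symm ?_)
  exact Commute.sum_right _ _ _ fun i _ => (hK _).mul_right (hX.pow_right i)

theorem const_mem_center (z : constants δ) : const δ (z : K) ∈ Subring.center (OrePoly δ) := by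
  refine mem_center_of_commute _ ?_ fun a => ?_
  · have h := var_mul_const (δ := δ) (z : K)
    rw [show δ (z : K) = 0 from z.2, map_zero, add_zero] at h
    exact h.symm
  · exact (Commute.all (z : K) a).map (const δ)

/-! ### The minimal polynomial of the derivation -/

/-- A derivation of `K` as an additive endomorphism of `K`. -/
def toEnd (δ : Derivation ℤ K K) : AddMonoid.End K := AddMonoidHom.mk' δ (map_add δ)

/-- `P = ∑ aᵢ Xⁱ` annihilates `δ`: the additive map `∑ aᵢ δⁱ : K → K` vanishes. -/
def Annihilates (δ : Derivation ℤ K K) (P : K[X]) : Prop :=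
  evalEnd (toEnd δ) P = 0

/-- `Z` is a monic polynomial of minimal degree among those in `K[X]` that annihilate `δ`. -/
def IsMinimalAnnihilator (δ : Derivation ℤ K K) (Z : K[X]) : Prop :=
  Z.Monic ∧ Annihilates δ Z ∧ ∀ Q : K[X], Q.Monic → Annihilates δ Q → Z.natDegree ≤ Q.natDegree

theorem pseudoLinear (a : K) :
    toEnd δ * Module.toAddMonoidEnd K K a =
      Module.toAddMonoidEnd K K a * toEnd δ +
        Module.toAddMonoidEnd K K (δ a) := by
  ext b
  change δ (a * b) = a * δ b + δ a * b
  simp [mul_comm]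

variable (δ) in
theorem exists_annihilates [FiniteDimensional (constants δ) K] :
    ∃ P : K[X], P.Monic ∧ Annihilates δ P := by
  let D : Module.End (constants δ) K :=
    { toFun := δ
      map_add' := map_add δ
      map_smul' := fun c x => by
        have hc : δ (c : K) = 0 := c.2
        simp [Subfield.smul_def, hc] }
  refine ⟨(minpoly (constants δ) D).map (algebraMap _ K),
    (minpoly.monic (Algebra.IsIntegral.isIntegral D)).map _, ?_⟩
  have key : ∀ p : (constants δ)[X], ∀ x : K,
      evalEnd (toEnd δ) (p.map (algebraMap _ K)) x = aeval D p x := by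
    intro p x
    induction p using Polynomial.induction_on' with
    | add p q hp hq =>
      rw [Polynomial.map_add, map_add, map_add, LinearMap.add_apply, ← hp, ← hq]; rfl
    | monomial n b =>
      rw [map_monomial, evalEnd_monomial, aeval_monomial]
      have hpow : ∀ y : K, (toEnd δ ^ n) y = (D ^ n) y := by
        induction n with
        | zero => intro y; rfl
        | succ n ih =>
          intro y
          rw [pow_succ, pow_succ]
          exact ih _
      change (b : K) * (toEnd δ ^ n) x = _
      rw [hpow]
      rfl
  ext x
  rw [key, minpoly.aeval]
  rfl

variable (δ) in
theorem exists_isMinimalAnnihilator [FiniteDimensional (constants δ) K] :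
    ∃ Z : K[X], IsMinimalAnnihilator δ Z := by
  obtain ⟨P, hP⟩ := exists_annihilates δ
  obtain ⟨Z, hZ, hmin⟩ := (measure (natDegree : K[X] → ℕ)).wf.has_min
    {P : K[X] | P.Monic ∧ Annihilates δ P} ⟨P, hP⟩
  exact ⟨Z, hZ.1, hZ.2, fun Q h1 h2 => not_lt.1 (hmin Q ⟨h1, h2⟩)⟩

/-- The polynomial `Z(X) ∈ K[X]`: the minimal polynomial of `δ` over `K`. -/
def minAnn (δ : Derivation ℤ K K) [FiniteDimensional (constants δ) K] : K[X] :=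
  (exists_isMinimalAnnihilator δ).choose

theorem minAnn_spec [FiniteDimensional (constants δ) K] :
    IsMinimalAnnihilator δ (minAnn δ) :=
  (exists_isMinimalAnnihilator δ).choose_spec

/-- A polynomial of degree smaller than that of `Z` that annihilates `δ` is zero. -/
theorem IsMinimalAnnihilator.eq_zero {Z P : K[X]} (hZ : IsMinimalAnnihilator δ Z)
    (hP : Annihilates δ P) (hd : P.degree < Z.degree) : P = 0 := by
  by_contra h0
  have hm : (P.leadingCoeff⁻¹ • P).Monic := by
    rw [Polynomial.smul_eq_C_mul, mul_comm]
    exact monic_mul_leadingCoeff_inv h0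
  have ha : Annihilates δ (P.leadingCoeff⁻¹ • P) := by
    unfold Annihilates at *
    rw [evalEnd_smul, hP, mul_zero]
  have h1 := hZ.2.2 _ hm ha
  have h2 := natDegree_lt_natDegree h0 hd
  have h3 := natDegree_smul_le P.leadingCoeff⁻¹ P
  omega

/-- The minimal polynomial is unique. -/
theorem IsMinimalAnnihilator.unique {Z Z' : K[X]} (hZ : IsMinimalAnnihilator δ Z)
    (hZ' : IsMinimalAnnihilator δ Z') : Z = Z' := by
  have hd : Z.natDegree = Z'.natDegree :=
    le_antisymm (hZ.2.2 _ hZ'.1 hZ'.2.1) (hZ'.2.2 _ hZ.1 hZ.2.1)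
  refine sub_eq_zero.1 (hZ.eq_zero ?_ ?_)
  · unfold Annihilates
    rw [map_sub, hZ.2.1, hZ'.2.1, sub_zero]
  · refine degree_sub_lt_left ?_ hZ.1.ne_zero ?_
    · rw [degree_eq_natDegree hZ.1.ne_zero, degree_eq_natDegree hZ'.1.ne_zero, hd]
    · rw [hZ.1.leadingCoeff, hZ'.1.leadingCoeff]

theorem coeff_mapCoeff (P : K[X]) (n : ℕ) : (mapCoeff δ P).coeff n = δ (P.coeff n) := by
  induction P using Polynomial.induction_on' with
  | add p q hp hq => rw [map_add, coeff_add, coeff_add, map_add, hp, hq]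
  | monomial m b =>
    rw [mapCoeff_monomial, coeff_monomial, coeff_monomial]
    split_ifs <;> simp

theorem mulX_pow_C_sub_mem (b : K) (n : ℕ) :
    ((mulX δ) ^ n) (C b) - monomial n b ∈ degreeLT K n := by
  induction n with
  | zero =>
    rw [monomial_zero_left]
    change C b - C b ∈ _
    rw [sub_self]
    exact zero_mem _
  | succ n ih =>
    have h : ((mulX δ) ^ (n + 1)) (C b) - monomial (n + 1) b =
        mulX δ (((mulX δ) ^ n) (C b) - monomial n b) + monomial n (δ b) := by
      rw [map_sub, mulX_monomial, pow_succ']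
      change mulX δ (((mulX δ) ^ n) (C b)) - _ = mulX δ (((mulX δ) ^ n) (C b)) - _ + _
      abel
    rw [h]
    generalize ((mulX δ) ^ n) (C b) - monomial n b = R at ih
    rw [mem_degreeLT] at ih ⊢
    refine lt_of_le_of_lt (degree_add_le _ _) (max_lt ?_ ?_)
    · change degree (X * R + mapCoeff δ R) < _
      refine (degree_lt_iff_coeff_zero _ _).2 fun m hm => ?_
      have hR := (degree_lt_iff_coeff_zero _ _).1 ih
      obtain ⟨k, rfl⟩ : ∃ k, m = k + 1 := ⟨m - 1, by omega⟩
      rw [coeff_add, coeff_X_mul, coeff_mapCoeff, hR k (by omega), hR (k + 1) (by omega),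
        map_zero, add_zero]
    · exact lt_of_le_of_lt (degree_monomial_le _ _) (by exact_mod_cast Nat.lt_succ_self n)

theorem evalEnd_C_sub_mem (P : K[X]) (b : K) :
    evalEnd (mulX δ) P (C b) - b • P ∈ degreeLT K P.natDegree := by
  have h : evalEnd (mulX δ) P (C b) - b • P =
      P.sum fun i a => a • (((mulX δ) ^ i) (C b) - monomial i b) := by
    have h1 : evalEnd (mulX δ) P (C b) = P.sum fun i a => a • ((mulX δ) ^ i) (C b) := by
      conv_lhs => rw [← Polynomial.sum_monomial_eq P]
      simp only [Polynomial.sum, map_sum, evalEnd_monomial]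
      exact AddMonoidHom.finsetSum_apply (M := K[X]) (N := K[X]) _ _ _
    have h2 : b • P = P.sum fun i a => a • monomial i b := by
      conv_lhs => rw [← Polynomial.sum_monomial_eq P]
      simp only [Polynomial.sum, Finset.smul_sum, smul_monomial, smul_eq_mul, mul_comm]
    rw [h1, h2]
    simp only [Polynomial.sum, smul_sub, Finset.sum_sub_distrib]
  rw [h]
  refine Submodule.sum_mem _ fun i hi => Submodule.smul_mem _ _ ?_
  rcases (le_natDegree_of_mem_supp i hi).lt_or_eq with hlt | heq
  · exact degreeLT_mono hlt.le (mulX_pow_C_sub_mem b i)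
  · rw [← heq]
    exact mulX_pow_C_sub_mem b i

/-- `P · X` is the usual product in `K[X; id, δ]`. -/
theorem evalEnd_mulX_X (P : K[X]) : evalEnd (mulX δ) P X = X * P := by
  induction P using Polynomial.induction_on' with
  | add p q hp hq =>
    rw [map_add, mul_add, ← hp, ← hq]
    rfl
  | monomial n b =>
    rw [evalEnd_monomial, X_mul_monomial]
    change b • ((mulX δ) ^ n) X = _
    have h3 : ((mulX δ) ^ n) X = monomial (n + 1) (1 : K) := by
      rw [← mulX_pow_monomial (δ := δ), pow_succ]
      change _ = ((mulX δ) ^ n) (mulX δ (1 : K[X]))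
      rw [← monomial_zero_one, mulX_monomial]
      simp [← monomial_one_one_eq_X]
    rw [h3, smul_monomial, smul_eq_mul, mul_one]

/-- `Z(X)` is central in `K[X; id, δ]`. -/
theorem minAnn_mem_center (δ : Derivation ℤ K K) [FiniteDimensional (constants δ) K] :
    ofPoly δ (minAnn δ) ∈ Subring.center (OrePoly δ) := by
  have hZ := minAnn_spec (δ := δ)
  set Z := minAnn δ
  have hdeg : Z.degree = Z.natDegree := degree_eq_natDegree hZ.1.ne_zero
  refine mem_center_of_commute _ ?_ fun a => ?_
  · have h0 : mapCoeff δ Z = 0 := by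
      refine hZ.eq_zero ?_ ?_
      · have h1 : mapCoeff δ Z = mulX δ Z - evalEnd (mulX δ) Z X := by
          rw [evalEnd_mulX_X]
          change _ = X * Z + mapCoeff δ Z - X * Z
          abel
        unfold Annihilates
        rw [h1, map_sub, evalEnd_mulX _ pseudoLinear, evalEnd_mul _ pseudoLinear, hZ.2.1,
          mul_zero, zero_mul, sub_zero]
      · rw [hdeg]
        refine (degree_lt_iff_coeff_zero _ _).2 fun m hm => ?_
        rw [coeff_mapCoeff]
        rcases hm.eq_or_lt with h | h
        · rw [← h, coeff_natDegree, hZ.1.leadingCoeff, Derivation.map_one_eq_zero]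
        · rw [coeff_eq_zero_of_natDegree_lt h, map_zero]
    change ofPoly δ (evalEnd (mulX δ) Z X) = var δ * ofPoly δ Z
    rw [evalEnd_mulX_X, var_mul]
    change _ = ofPoly δ (X * Z + mapCoeff δ Z)
    rw [h0, add_zero]
  · have h0 : evalEnd (mulX δ) Z (C a) - a • Z = 0 := by
      refine hZ.eq_zero ?_ ?_
      · unfold Annihilates
        rw [map_sub, evalEnd_smul, evalEnd_mul _ pseudoLinear, hZ.2.1, mul_zero, zero_mul,
          sub_zero]
      · rw [hdeg]
        exact mem_degreeLT.1 (evalEnd_C_sub_mem Z a)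
    change ofPoly δ (evalEnd (mulX δ) Z (C a)) = const δ a * ofPoly δ Z
    rw [const_mul, sub_eq_zero.1 h0]

/-- The central element `N = Z(X) - z` of `K[X; id, δ]`, for a constant `z ∈ F`. -/
def centralN (δ : Derivation ℤ K K) [FiniteDimensional (constants δ) K] (z : constants δ) :
    Subring.center (OrePoly δ) :=
  ⟨ofPoly δ (minAnn δ), minAnn_mem_center δ⟩ - ⟨const δ (z : K), const_mem_center z⟩

end

end DiffOre

/-! ### Completion of a noncommutative ring along a central element -/

namespace CentralAdic

variable {A : Type*} [Ring A]

/-- The ideal `cA = {c f | f ∈ A}` generated by a central element `c` of a ring `A`. -/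
def principal (c : Subring.center A) : Ideal A where
  carrier := {x | ∃ f : A, x = (c : A) * f}
  zero_mem' := ⟨0, by simp⟩
  add_mem' := by
    rintro _ _ ⟨f, rfl⟩ ⟨g, rfl⟩
    exact ⟨f + g, by rw [mul_add]⟩
  smul_mem' := by
    rintro a _ ⟨f, rfl⟩
    exact ⟨a * f, by
      rw [smul_eq_mul, ← mul_assoc, ← mul_assoc, Subring.mem_center_iff.1 c.2 a]⟩

instance (c : Subring.center A) : (principal c).IsTwoSided where
  mul_mem_of_left b := by
    rintro ⟨f, rfl⟩
    exact ⟨f * b, by rw [mul_assoc]⟩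

theorem principal_pow_le (c : Subring.center A) {m n : ℕ} (h : m ≤ n) :
    principal (c ^ n) ≤ principal (c ^ m) := by
  rintro _ ⟨f, rfl⟩
  obtain ⟨k, rfl⟩ := Nat.exists_eq_add_of_le h
  exact ⟨((c ^ k : Subring.center A) : A) * f, by
    rw [pow_add, Subring.coe_mul, mul_assoc]⟩

theorem principal_pow_one_le (c : Subring.center A) :
    principal (c ^ ((1 : ℕ+) : ℕ)) ≤ principal c := by
  rw [PNat.one_coe, pow_one]

/-- The inverse limit `lim_{m > 0} A / c^m A`, as the subring of the product `∏_{m > 0} A / c^m A`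
of the families that are compatible with the projections `A / c^n A → A / c^m A`, `m ≤ n`. -/
def limit (c : Subring.center A) :
    Subring (∀ m : ℕ+, A ⧸ principal (c ^ (m : ℕ))) where
  carrier := {f | ∀ (m n : ℕ+) (h : (m : ℕ) ≤ n),
    Ideal.Quotient.factor (principal_pow_le c h) (f n) = f m}
  mul_mem' hf hg m n h := by
    rw [Pi.mul_apply, Pi.mul_apply, map_mul, hf m n h, hg m n h]
  one_mem' m n h := by rw [Pi.one_apply, Pi.one_apply, map_one]
  add_mem' hf hg m n h := by
    rw [Pi.add_apply, Pi.add_apply, map_add, hf m n h, hg m n h]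
  zero_mem' m n h := by rw [Pi.zero_apply, Pi.zero_apply, map_zero]
  neg_mem' hf m n h := by rw [Pi.neg_apply, Pi.neg_apply, map_neg, hf m n h]

/-- The canonical map `A → lim_{m > 0} A / c^m A`. -/
def toLimit (c : Subring.center A) : A →+* limit c :=
  (RingHom.pi fun m : ℕ+ => Ideal.Quotient.mk (principal (c ^ (m : ℕ)))).codRestrict (limit c)
    fun _ _ _ _ => rfl

/-- The reduction modulo `c`, from `lim_{m > 0} A / c^m A` to `A / c A`: a compatible family is
sent to its component of index `m = 1`. -/
def reduction (c : Subring.center A) : limit c →+* A ⧸ principal c :=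
  ((Ideal.Quotient.factor (principal_pow_one_le c)).comp
    (Pi.evalRingHom (fun m : ℕ+ => A ⧸ principal (c ^ (m : ℕ))) 1)).comp (limit c).subtype

end CentralAdic

end

/-! It suffices to find a morphism `ψ` from `A = K[X; id, δ]` to `(A/N)[[T]]` that fixes `K`, lifts
the projection and sends `N` to `T`: dividing repeatedly by `N` on one side and by `T` on the other,
such a `ψ` identifies `A/N^m` with series modulo `T^m` for every `m`, hence extends to the
completion (`exists_limit_equiv`).

To build `ψ`, deform the variable. For any `c ∈ K` and a central indeterminate `t`, the element `X +
c t` obeys the same commutation rule with `K` as `X`, so `X ↦ X + c t` defines a morphism `A →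
A[t]`. The image of the central element `Z` commutes with `K` and `X`, and its coefficients in
positive degrees of `t` have degree less than `deg Z` in `X`; minimality of `Z` forces them into
`F`. So the image is `Z + H(t)` with `H ∈ F[t]` and `H(0) = 0`
(`IsMinimalAnnihilator.exists_deform_eq`).

The linear coefficient of `H` is the value at `c` of the operator given by `(Z - Z(0))/X`, a nonzero
polynomial of degree less than `deg Z`. By minimality this operator is not zero, so some `c` makes
the coefficient nonzero. Then `H` has a compositional inverse `τ ∈ F[[T]]`, and `t = τ(T)` turns `Z`
into `Z + T`. Modulo `N` one has `Z = z`, hence `N ↦ T`. -/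

namespace CentralAdic

open PowerSeries

/-! ### Extending a morphism to the completion along a central element. -/

section

variable {A : Type*} [Ring A] {c : Subring.center A} {ψ : A →+* (A ⧸ principal c)⟦X⟧}

/-- The constant coefficient of `ψ a` detects divisibility of `a` by `c`, and writing `a = c b`
shifts the coefficients of `ψ b` by one, so induction applies to `b`. No regularity of `c` is
needed. -/
theorem mem_principal_pow_iff (hc : ψ c = X)
    (h0 : ∀ a, constantCoeff (ψ a) = Ideal.Quotient.mk (principal c) a) (m : ℕ) (a : A) :
    a ∈ principal (c ^ m) ↔ ∀ n < m, coeff n (ψ a) = 0 := by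
  constructor
  · rintro ⟨f, rfl⟩ n hn
    rw [map_mul, Subring.coe_pow, map_pow, hc, coeff_X_pow_mul', if_neg (by omega)]
  · induction m generalizing a with
    | zero => exact fun _ => ⟨a, by simp⟩
    | succ m ih =>
      intro h
      have h1 : a ∈ principal c := by
        rw [← Ideal.Quotient.eq_zero_iff_mem, ← h0, ← coeff_zero_eq_constantCoeff_apply]
        exact h 0 m.succ_pos
      obtain ⟨b, rfl⟩ := h1
      obtain ⟨f, hf⟩ := ih b fun n hn => by
        have h2 := h (n + 1) (by omega)
        rwa [map_mul, hc, coeff_succ_X_mul] at h2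
      refine ⟨f, ?_⟩
      rw [hf, pow_succ', Subring.coe_mul, mul_assoc]

theorem mk_eq_mk_iff_coeff (hc : ψ c = X)
    (h0 : ∀ a, constantCoeff (ψ a) = Ideal.Quotient.mk (principal c) a) (m : ℕ) (a b : A) :
    Ideal.Quotient.mk (principal (c ^ m)) a = Ideal.Quotient.mk (principal (c ^ m)) b ↔
      ∀ n < m, coeff n (ψ a) = coeff n (ψ b) := by
  rw [Ideal.Quotient.mk_eq_mk_iff_sub_mem, mem_principal_pow_iff hc h0]
  simp only [map_sub, sub_eq_zero]

/-- Successive approximation: a lift of the constant coefficient leaves an error divisible by `X`,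
and the quotient is approximated to one order less. This density gives surjectivity on the limit. -/
theorem exists_coeff_eq (hc : ψ c = X)
    (h0 : ∀ a, constantCoeff (ψ a) = Ideal.Quotient.mk (principal c) a) (m : ℕ)
    (g : (A ⧸ principal c)⟦X⟧) : ∃ a, ∀ n < m, coeff n (ψ a) = coeff n g := by
  induction m generalizing g with
  | zero => exact ⟨0, by simp⟩
  | succ m ih =>
    obtain ⟨b, hb⟩ := Ideal.Quotient.mk_surjective (constantCoeff g)
    obtain ⟨h, hh⟩ : X ∣ g - ψ b := by rw [X_dvd_iff, map_sub, h0, hb, sub_self]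
    obtain ⟨a, ha⟩ := ih h
    refine ⟨b + c * a, fun n hn => ?_⟩
    rw [← sub_add_cancel g (ψ b), hh, map_add ψ, map_mul, hc, add_comm, map_add, map_add]
    congr 1
    cases n with
    | zero => simp
    | succ n => rw [coeff_succ_X_mul, coeff_succ_X_mul, ha n (by omega)]

variable (ψ) in
/-- The series whose coefficient of index `n` is that of `ψ a`, for a lift `a` of the component of
index `n + 1` of `f`. -/
noncomputable def toSeries (f : limit c) : (A ⧸ principal c)⟦X⟧ :=
  PowerSeries.mk fun n => coeff n
    (ψ (Function.surjInv Ideal.Quotient.mk_surjective (f.1 ⟨n + 1, n.succ_pos⟩)))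

/-- The chosen lifts do not matter: the coefficient of index `n` depends only on the class modulo `c
^ (n + 1)`, which every component of index `m > n` determines. -/
theorem coeff_toSeries (hc : ψ c = X)
    (h0 : ∀ a, constantCoeff (ψ a) = Ideal.Quotient.mk (principal c) a) (f : limit c) (m : ℕ+)
    (a : A) (ha : Ideal.Quotient.mk _ a = f.1 m) (n : ℕ) (hn : n < m) :
    coeff n (toSeries ψ f) = coeff n (ψ a) := by
  rw [toSeries, coeff_mk]
  refine (mk_eq_mk_iff_coeff hc h0 (n + 1) _ _).1 ?_ n n.lt_succ_self
  have h1 := f.2 ⟨n + 1, n.succ_pos⟩ m hn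
  rw [← ha] at h1
  exact (Function.surjInv_eq Ideal.Quotient.mk_surjective _).trans h1.symm

/-- A morphism `ψ : A → (A / cA)[[T]]` that sends `c` to `T` and lifts the projection `A → A / cA`
extends to an isomorphism from the completion of `A` along `c`. -/
theorem exists_limit_equiv (hc : ψ c = X)
    (h0 : ∀ a, constantCoeff (ψ a) = Ideal.Quotient.mk (principal c) a) :
    ∃ φ : limit c ≃+* (A ⧸ principal c)⟦X⟧,
      (∀ a, φ (toLimit c a) = ψ a) ∧ ∀ f, constantCoeff (φ f) = reduction c f := by
  have key := coeff_toSeries hc h0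
  have lift (f : limit c) (m : ℕ+) : ∃ a, Ideal.Quotient.mk _ a = f.1 m :=
    Ideal.Quotient.mk_surjective _
  let Φ : limit c →+* (A ⧸ principal c)⟦X⟧ :=
    { toFun := toSeries ψ
      map_one' := by
        ext n
        rw [key 1 ⟨n + 1, n.succ_pos⟩ 1 rfl n n.lt_succ_self, map_one]
      map_zero' := by
        ext n
        rw [key 0 ⟨n + 1, n.succ_pos⟩ 0 rfl n n.lt_succ_self, map_zero]
      map_add' := fun f g => by
        ext n
        obtain ⟨a, ha⟩ := lift f ⟨n + 1, n.succ_pos⟩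
        obtain ⟨b, hb⟩ := lift g ⟨n + 1, n.succ_pos⟩
        rw [map_add, key f _ a ha n n.lt_succ_self, key g _ b hb n n.lt_succ_self,
          key (f + g) ⟨n + 1, n.succ_pos⟩ (a + b) (by rw [map_add, ha, hb]; rfl) n n.lt_succ_self,
          map_add, map_add]
      map_mul' := fun f g => by
        ext n
        obtain ⟨a, ha⟩ := lift f ⟨n + 1, n.succ_pos⟩
        obtain ⟨b, hb⟩ := lift g ⟨n + 1, n.succ_pos⟩
        rw [key (f * g) ⟨n + 1, n.succ_pos⟩ (a * b) (by rw [map_mul, ha, hb]; rfl) n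
          n.lt_succ_self, map_mul, coeff_mul, coeff_mul]
        -- Both indices in the convolution are at most `n`, so the same lifts at level `n + 1`
        -- compute all the coefficients involved.
        refine Finset.sum_congr rfl fun p hp => ?_
        have hp' := Finset.HasAntidiagonal.mem_antidiagonal.1 hp
        rw [key f _ a ha p.1 (show p.1 < n + 1 by omega),
          key g _ b hb p.2 (show p.2 < n + 1 by omega)] }
  have hinj : Function.Injective Φ := by
    rw [injective_iff_map_eq_zero]
    intro f hf
    ext m
    obtain ⟨a, ha⟩ := lift f m
    rw [← ha]
    refine Ideal.Quotient.eq_zero_iff_mem.2 ((mem_principal_pow_iff hc h0 m a).2 fun n hn => ?_)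
    rw [← key f m a ha n hn]
    change coeff n (Φ f) = 0
    rw [hf, map_zero]
  have hsurj : Function.Surjective Φ := by
    intro g
    -- The approximations `a m` agree with `g` below order `m`, so their classes form a compatible
    -- family.
    choose a ha using fun m => exists_coeff_eq hc h0 m g
    refine ⟨⟨fun m => Ideal.Quotient.mk _ (a m), fun m n h => ?_⟩, ?_⟩
    · refine (mk_eq_mk_iff_coeff hc h0 m _ _).2 fun i hi => ?_
      rw [ha _ i hi, ha _ i (by omega)]
    · ext n
      exact (key _ ⟨n + 1, n.succ_pos⟩ _ rfl n n.lt_succ_self).trans (ha _ n n.lt_succ_self)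
  refine ⟨RingEquiv.ofBijective Φ ⟨hinj, hsurj⟩, fun a => ?_, fun f => ?_⟩
  · ext n
    exact key _ ⟨n + 1, n.succ_pos⟩ _ rfl n n.lt_succ_self
  · obtain ⟨a, ha⟩ := lift f 1
    have h1 : constantCoeff (toSeries ψ f) = Ideal.Quotient.mk (principal c) a := by
      rw [← coeff_zero_eq_constantCoeff_apply, key f 1 a ha 0 one_pos,
        coeff_zero_eq_constantCoeff_apply, h0]
    have h2 : reduction c f = Ideal.Quotient.factor (principal_pow_one_le c) (f.1 1) := rfl
    rw [h2, ← ha]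
    exact h1

end

end CentralAdic

namespace DiffOre

open Polynomial

section

variable {K : Type*} [Field K] {δ : Derivation ℤ K K}

/-! ### Morphisms out of the Ore polynomial ring -/

/-- The universal property of `K[X; id, δ]`: a morphism `f : K → R` and an element `x` of `R` such
that `x f(a) = f(a) x + f(δ(a))` define a morphism `K[X; id, δ] → R`. -/
noncomputable def lift {R : Type*} [Ring R] (f : K →+* R) (x : R)
    (h : ∀ a, x * f a = f a * x + f (δ a)) : OrePoly δ →+* R where
  toFun P := eval₂ f x ((ofPoly δ).symm P)
  map_zero' := eval₂_zero _ _
  map_one' := eval₂_one _ _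
  map_add' _ _ := eval₂_add _ _
  map_mul' P Q := by
    -- With `R` a `K`-module through `f`, left multiplication by `x` is pseudo-linear and evaluating
    -- `P` at it is left multiplication by the image of `P`. Multiplicativity is then `evalEnd_mul`
    -- applied to `1`.
    let _ : Module K R := Module.compHom R f
    let u : AddMonoid.End R := AddMonoidHom.mulLeft x
    have key : ∀ (P : K[X]) (r : R),
        evalEnd (u) P r = eval₂ f x P * r := by
      intro P r
      induction P using Polynomial.induction_on' with
      | add p q hp hq => rw [eval₂_add, add_mul, ← hp, ← hq, map_add]; rfl
      | monomial n b =>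
        rw [evalEnd_monomial, eval₂_monomial, mul_assoc]
        change f b * (u ^ n) r = _
        congr 1
        induction n with
        | zero => rw [pow_zero, pow_zero, one_mul]; rfl
        | succ n ih =>
          rw [pow_succ', pow_succ', mul_assoc, ← ih]
          rfl
    have hu : ∀ a : K, u * Module.toAddMonoidEnd K R a =
        Module.toAddMonoidEnd K R a * u +
          Module.toAddMonoidEnd K R (δ a) := by
      intro a
      ext r
      change x * (f a * r) = f a * (x * r) + f (δ a) * r
      rw [← mul_assoc, h, add_mul, mul_assoc]
    have h1 := DFunLike.congr_fun (evalEnd_mul u hu ((ofPoly δ).symm P) ((ofPoly δ).symm Q)) 1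
    rw [key, mul_one] at h1
    refine h1.trans ?_
    change evalEnd u _ (evalEnd u _ 1) = _
    rw [key, key, mul_one]

theorem lift_const {R : Type*} [Ring R] (f : K →+* R) (x : R)
    (h : ∀ a, x * f a = f a * x + f (δ a)) (a : K) : lift f x h (const δ a) = f a :=
  eval₂_C f x

theorem lift_var {R : Type*} [Ring R] (f : K →+* R) (x : R)
    (h : ∀ a, x * f a = f a * x + f (δ a)) : lift f x h (var δ) = x :=
  eval₂_X f x

theorem ringHom_ext {R : Type*} [Ring R] {f g : OrePoly δ →+* R}
    (hK : ∀ a, f (const δ a) = g (const δ a)) (hX : f (var δ) = g (var δ)) : f = g := by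
  ext P
  obtain ⟨P, rfl⟩ := (ofPoly δ).surjective P
  simp only [ofPoly_eq_sum, Polynomial.sum, map_sum, map_mul, map_pow, hK, hX]

/-! ### Coefficients of Ore polynomials -/

variable (δ) in
/-- The coefficient of index `m` of an Ore polynomial. -/
noncomputable def oreCoeff (m : ℕ) : OrePoly δ →+ K :=
  (lcoeff K m).toAddMonoidHom.comp (ofPoly δ).symm.toAddMonoidHom

theorem oreCoeff_ofPoly (m : ℕ) (P : K[X]) : oreCoeff δ m (ofPoly δ P) = P.coeff m := rfl

theorem oreCoeff_const_mul (m : ℕ) (a : K) (P : OrePoly δ) :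
    oreCoeff δ m (const δ a * P) = a * oreCoeff δ m P := by
  obtain ⟨P, rfl⟩ := (ofPoly δ).surjective P
  rw [const_mul, oreCoeff_ofPoly, oreCoeff_ofPoly, coeff_smul, smul_eq_mul]

theorem oreCoeff_zero_var_mul (P : OrePoly δ) :
    oreCoeff δ 0 (var δ * P) = δ (oreCoeff δ 0 P) := by
  obtain ⟨P, rfl⟩ := (ofPoly δ).surjective P
  rw [var_mul, oreCoeff_ofPoly, oreCoeff_ofPoly]
  change (X * P + mapCoeff δ P).coeff 0 = _
  rw [coeff_add, coeff_mapCoeff, coeff_X_mul_zero, zero_add]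

theorem oreCoeff_succ_var_mul (m : ℕ) (P : OrePoly δ) :
    oreCoeff δ (m + 1) (var δ * P) = oreCoeff δ m P + δ (oreCoeff δ (m + 1) P) := by
  obtain ⟨P, rfl⟩ := (ofPoly δ).surjective P
  rw [var_mul, oreCoeff_ofPoly, oreCoeff_ofPoly, oreCoeff_ofPoly]
  change (X * P + mapCoeff δ P).coeff (m + 1) = _
  rw [coeff_add, coeff_mapCoeff, coeff_X_mul]

theorem const_injective : Function.Injective (const δ) :=
  fun _ _ h => C_injective ((ofPoly δ).injective h)

/-- The constants of `δ`, as elements of `K[X; id, δ]`. -/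
noncomputable def constF (δ : Derivation ℤ K K) : constants δ →+* OrePoly δ :=
  (const δ).comp (constants δ).subtype

theorem exists_constF_eq {a : K} (h : Commute (const δ a) (var δ)) :
    const δ a ∈ (constF δ).range := by
  refine ⟨⟨a, ?_⟩, rfl⟩
  have h1 := var_mul_const (δ := δ) a
  rw [← h.eq] at h1
  exact const_injective (δ := δ) ((left_eq_add.1 h1).trans (map_zero _).symm)

/-! ### Centralizer of the coefficients -/

/-- Every positive power of `δ` kills `1`. -/
theorem evalEnd_toEnd_one (P : K[X]) : evalEnd (toEnd δ) P 1 = P.coeff 0 := by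
  induction P using Polynomial.induction_on' with
  | add p q hp hq => rw [coeff_add, ← hp, ← hq, map_add]; rfl
  | monomial n b =>
    rw [evalEnd_monomial]
    change b * (toEnd δ ^ n) 1 = _
    cases n with
    | zero => simp
    | succ n =>
      rw [pow_succ, coeff_monomial, if_neg n.succ_ne_zero]
      change b * (toEnd δ ^ n) (δ 1) = _
      rw [Derivation.map_one_eq_zero, map_zero, mul_zero]

theorem IsMinimalAnnihilator.natDegree_pos {Z : K[X]} (hZ : IsMinimalAnnihilator δ Z) :
    0 < Z.natDegree := by
  refine Nat.pos_of_ne_zero fun h => ?_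
  have h1 := hZ.2.1
  rw [Annihilates, (hZ.1.natDegree_eq_zero).1 h, evalEnd_one] at h1
  exact one_ne_zero (α := K) (DFunLike.congr_fun h1 1)

/-- An Ore polynomial of degree smaller than that of `Z` that commutes with `K` is constant. -/
theorem IsMinimalAnnihilator.eq_const {Z : K[X]} (hZ : IsMinimalAnnihilator δ Z)
    {P : OrePoly δ} (hP : ∀ a, Commute P (const δ a))
    (hd : ∀ m, Z.natDegree ≤ m → oreCoeff δ m P = 0) : P = const δ (oreCoeff δ 0 P) := by
  obtain ⟨P, rfl⟩ := (ofPoly δ).surjective P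
  change P = C (P.coeff 0)
  refine sub_eq_zero.1 (hZ.eq_zero ?_ ?_)
  · unfold Annihilates
    ext a
    have h1 : evalEnd (mulX δ) P (C a) = evalEnd (mulX δ) (C a) P := hP a
    have hC : ∀ (b c : K), evalEnd (toEnd δ) (C b) c = b * c := fun b c => by
      rw [← monomial_zero_left, evalEnd_monomial]; rfl
    -- Evaluating `P a = a P` at `δ` and applying it to `1` shows that `P(δ)` is multiplication by
    -- the constant coefficient of `P`.
    have h2 : evalEnd (toEnd δ) P (evalEnd (toEnd δ) (C a) 1) =
        evalEnd (toEnd δ) (C a) (evalEnd (toEnd δ) P 1) := by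
      have h3 := congr_arg (evalEnd (toEnd δ)) h1
      rw [evalEnd_mul (toEnd δ) pseudoLinear, evalEnd_mul (toEnd δ) pseudoLinear] at h3
      exact DFunLike.congr_fun h3 1
    rw [hC, mul_one, hC, evalEnd_toEnd_one] at h2
    rw [map_sub]
    change evalEnd (toEnd δ) P a - evalEnd (toEnd δ) (C (P.coeff 0)) a = 0
    rw [h2, hC, mul_comm, sub_self]
  · rw [degree_eq_natDegree hZ.1.ne_zero]
    refine (degree_lt_iff_coeff_zero _ _).2 fun m hm => ?_
    rw [coeff_sub, coeff_C, if_neg (by have := hZ.natDegree_pos; omega), sub_zero]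
    exact hd m hm

/-! ### The deformation `X ↦ X + c t` -/

/-- The morphism `K[X; id, δ] → K[X; id, δ][t]` that is the identity on `K` and sends `X` to
`X + c t`, for a central indeterminate `t`. -/
noncomputable def deform (δ : Derivation ℤ K K) (c : K) : OrePoly δ →+* (OrePoly δ)[X] :=
  lift (Polynomial.C.comp (const δ)) (Polynomial.C (var δ) + Polynomial.C (const δ c) * X)
    fun a => by
      rw [RingHom.comp_apply, RingHom.comp_apply, add_mul, mul_assoc, X_mul_C, ← mul_assoc,
        ← Polynomial.C_mul, var_mul_const, ← Polynomial.C_mul, mul_add, ← mul_assoc,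
        ← Polynomial.C_mul, ← Polynomial.C_mul, Polynomial.C_add, ← map_mul, ← map_mul,
        mul_comm c a]
      abel

variable (c : K)

theorem deform_const (a : K) : deform δ c (const δ a) = Polynomial.C (const δ a) :=
  lift_const _ _ _ a

theorem deform_var :
    deform δ c (var δ) = Polynomial.C (var δ) + Polynomial.C (const δ c) * X :=
  lift_var _ _ _

theorem coeff_zero_deform (P : OrePoly δ) : (deform δ c P).coeff 0 = P := by
  have h : Polynomial.constantCoeff.comp (deform δ c) = RingHom.id (OrePoly δ) := by
    refine ringHom_ext (fun a => ?_) ?_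
    · simp [deform_const]
    · simp [deform_var]
  exact DFunLike.congr_fun h P

theorem coeff_zero_deform_var_mul (P : OrePoly δ) :
    (deform δ c (var δ * P)).coeff 0 = var δ * (deform δ c P).coeff 0 := by
  rw [coeff_zero_deform, coeff_zero_deform]

theorem coeff_succ_deform_var_mul (P : OrePoly δ) (j : ℕ) :
    (deform δ c (var δ * P)).coeff (j + 1) =
      var δ * (deform δ c P).coeff (j + 1) + const δ c * (deform δ c P).coeff j := by
  rw [map_mul, deform_var, add_mul, mul_assoc, coeff_add, coeff_C_mul, coeff_C_mul, coeff_X_mul]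

/-- The total degree of `(X + c t)^i` in `X` and `t` is at most `i`: moving `X` past a coefficient
never raises it. -/
theorem oreCoeff_coeff_deform_var_pow (i j m : ℕ) (h : i < j + m) :
    oreCoeff δ m ((deform δ c (var δ ^ i)).coeff j) = 0 := by
  induction i generalizing j m with
  | zero =>
    rw [pow_zero, map_one, coeff_one]
    split_ifs with hj
    · rw [one_def, oreCoeff_ofPoly, coeff_one, if_neg (by omega)]
    · exact map_zero _
  | succ i ih =>
    rw [pow_succ']
    have hv : oreCoeff δ m (var δ * (deform δ c (var δ ^ i)).coeff j) = 0 := by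
      cases m with
      | zero => rw [oreCoeff_zero_var_mul, ih _ _ (by omega), map_zero]
      | succ m =>
        rw [oreCoeff_succ_var_mul, ih _ _ (by omega), ih _ _ (by omega), map_zero, add_zero]
    cases j with
    | zero => rwa [coeff_zero_deform_var_mul]
    | succ j =>
      rw [coeff_succ_deform_var_mul, map_add, hv, oreCoeff_const_mul, ih _ _ (by omega),
        mul_zero, add_zero]

/-- The part linear in `t` is the sum of the `X^k c X^(i - k)`. Only `k = i` has a constant term,
since the others are right multiples of `X`. -/
theorem oreCoeff_zero_coeff_one_deform_var_pow_succ (i : ℕ) :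
    oreCoeff δ 0 ((deform δ c (var δ ^ (i + 1))).coeff 1) = (toEnd δ ^ i) c := by
  induction i with
  | zero =>
    rw [pow_succ', coeff_succ_deform_var_mul, pow_zero, map_one, coeff_one, coeff_one,
      if_neg (zero_add 1 ▸ one_ne_zero), if_pos rfl, mul_zero, zero_add, mul_one]
    exact coeff_C_zero
  | succ i ih =>
    rw [pow_succ', coeff_succ_deform_var_mul, map_add, oreCoeff_zero_var_mul, zero_add, ih,
      coeff_zero_deform, oreCoeff_const_mul, pow_succ' (var δ), oreCoeff_zero_var_mul]
    -- The constant coefficient of a power of `X` is `0` or `1`.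
    have h : δ (oreCoeff δ 0 (var δ ^ i)) = 0 := by
      clear ih
      induction i with
      | zero =>
        rw [pow_zero, one_def, oreCoeff_ofPoly, coeff_one_zero, Derivation.map_one_eq_zero]
      | succ i ih => rw [pow_succ', oreCoeff_zero_var_mul, ih, map_zero]
    rw [h, mul_zero, add_zero, pow_succ' (toEnd δ)]
    rfl

theorem coeff_deform_ofPoly (P : K[X]) (j : ℕ) : (deform δ c (ofPoly δ P)).coeff j =
    P.sum fun i a => const δ a * (deform δ c (var δ ^ i)).coeff j := by
  rw [ofPoly_eq_sum]
  simp only [Polynomial.sum, map_sum, map_mul, deform_const, finsetSum_coeff, coeff_C_mul]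

theorem oreCoeff_coeff_deform (P : K[X]) (j m : ℕ) (h : P.natDegree < j + m) :
    oreCoeff δ m ((deform δ c (ofPoly δ P)).coeff j) = 0 := by
  rw [coeff_deform_ofPoly, Polynomial.sum, map_sum]
  refine Finset.sum_eq_zero fun i hi => ?_
  have := le_natDegree_of_mem_supp i hi
  rw [oreCoeff_const_mul, oreCoeff_coeff_deform_var_pow c i j m (by omega), mul_zero]

theorem oreCoeff_zero_coeff_one_deform (P : K[X]) :
    oreCoeff δ 0 ((deform δ c (ofPoly δ P)).coeff 1) = evalEnd (toEnd δ) P.divX c := by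
  induction P using Polynomial.induction_on' with
  | add p q hp hq => rw [map_add, map_add, coeff_add, map_add, hp, hq, divX_add, map_add]; rfl
  | monomial n b =>
    rw [coeff_deform_ofPoly, sum_monomial_index _ _ (by rw [map_zero, zero_mul]),
      oreCoeff_const_mul, ← C_mul_X_pow_eq_monomial, divX_C_mul_X_pow]
    cases n with
    | zero =>
      rw [if_pos rfl, map_zero, oreCoeff_coeff_deform_var_pow c 0 1 0 (by omega), mul_zero]
      rfl
    | succ n =>
      rw [oreCoeff_zero_coeff_one_deform_var_pow_succ, if_neg n.succ_ne_zero,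
        Nat.add_sub_cancel, C_mul_X_pow_eq_monomial, evalEnd_monomial]
      rfl

/-- The deformation of `Z` is `Z + H(t)` for a polynomial `H` over the field of constants. -/
theorem IsMinimalAnnihilator.exists_deform_eq {Z : K[X]} (hZ : IsMinimalAnnihilator δ Z)
    (hc : ofPoly δ Z ∈ Subring.center (OrePoly δ)) :
    ∃ H : (constants δ)[X], H.coeff 0 = 0 ∧
      (H.coeff 1 : K) = evalEnd (toEnd δ) Z.divX c ∧
      deform δ c (ofPoly δ Z) = Polynomial.C (ofPoly δ Z) + H.map (constF δ) := by
  set Q := deform δ c (ofPoly δ Z) with hQ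
  have hcomm : ∀ P, Commute Q (deform δ c P) := fun P => by
    have h := Subring.mem_center_iff.1 hc P
    rw [Commute, SemiconjBy, hQ, ← map_mul, ← map_mul, h]
  have hK : ∀ a, Commute Q (Polynomial.C (const δ a)) := fun a => deform_const c a ▸ hcomm _
  -- `Q` commutes with `X + c t`, with `c` and with `t`, hence with `X`.
  have hX : Commute Q (Polynomial.C (var δ)) := by
    have h := (hcomm (var δ)).sub_right ((hK c).mul_right (commute_X Q).symm)
    rwa [deform_var, add_sub_cancel_right] at h
  have hcoeff : ∀ (P : OrePoly δ) (j : ℕ), Commute Q (Polynomial.C P) →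
      Commute (Q.coeff j) P := fun P j h => by
    have h1 : (Q * Polynomial.C P).coeff j = (Polynomial.C P * Q).coeff j := by rw [h.eq]
    rwa [coeff_mul_C, coeff_C_mul] at h1
  -- A positive power of `t` lowers the degree in `X` strictly below that of `Z`, so `eq_const`
  -- applies.
  have hconst : ∀ j, Q.coeff (j + 1) = const δ (oreCoeff δ 0 (Q.coeff (j + 1))) := fun j =>
    hZ.eq_const (fun a => hcoeff _ _ (hK a)) fun m hm =>
      oreCoeff_coeff_deform c Z _ m (by omega)
  have h0 : Q.coeff 0 = ofPoly δ Z := coeff_zero_deform c _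
  have hlift : Q - Polynomial.C (ofPoly δ Z) ∈ lifts (constF δ) := by
    rw [lifts_iff_coeff_lifts]
    intro j
    cases j with
    | zero => exact ⟨0, by rw [coeff_sub, coeff_C_zero, h0, sub_self, map_zero]⟩
    | succ j =>
      have h := hconst j
      rw [coeff_sub, coeff_C_succ, sub_zero, h]
      exact exists_constF_eq (h ▸ hcoeff _ _ hX)
  obtain ⟨H, hH⟩ := (mem_lifts _).1 hlift
  have hinj : Function.Injective (constF δ) := fun _ _ h =>
    Subtype.ext (const_injective h)
  refine ⟨H, hinj ?_, const_injective (δ := δ) ?_, by rw [hH, add_sub_cancel]⟩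
  · rw [← coeff_map, hH, coeff_sub, coeff_C_zero, h0, sub_self, map_zero]
  · change constF δ (H.coeff 1) = _
    rw [← coeff_map, hH, coeff_sub, coeff_C_succ, sub_zero, hconst 0]
    congr 1
    exact oreCoeff_zero_coeff_one_deform c Z

/-! ### Choice of `c` and substitution of the inverse series. -/

theorem IsMinimalAnnihilator.exists_evalEnd_divX_ne_zero {Z : K[X]}
    (hZ : IsMinimalAnnihilator δ Z) : ∃ c : K, evalEnd (toEnd δ) Z.divX c ≠ 0 := by
  by_contra! h
  have h1 := hZ.eq_zero (P := Z.divX) (AddMonoidHom.ext h) (degree_divX_lt hZ.1.ne_zero)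
  have h2 := hZ.natDegree_pos
  rw [divX_eq_zero_iff] at h1
  rw [h1, natDegree_C] at h2
  exact h2.false

/-- There is a morphism from `K[X; id, δ]` to the ring of power series over its quotient by `N`
that is the identity on `K`, lifts the projection, and sends `N` to `T`. -/
theorem exists_powerSeries_hom (δ : Derivation ℤ K K) [FiniteDimensional (constants δ) K]
    (z : constants δ) :
    ∃ ψ : OrePoly δ →+* PowerSeries (OrePoly δ ⧸ CentralAdic.principal (centralN δ z)),
      (∀ a, ψ (const δ a) = PowerSeries.C (Ideal.Quotient.mk _ (const δ a))) ∧
      ψ (centralN δ z) = PowerSeries.X ∧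
      ∀ P, PowerSeries.constantCoeff (ψ P) = Ideal.Quotient.mk _ P := by
  have hZ := minAnn_spec (δ := δ)
  obtain ⟨c, hc⟩ := hZ.exists_evalEnd_divX_ne_zero
  obtain ⟨H, H0, H1, hH⟩ := hZ.exists_deform_eq c (minAnn_mem_center δ)
  have hH1 : PowerSeries.coeff 1 (H : PowerSeries (constants δ)) ≠ 0 := by
    rw [coeff_coe]
    intro h
    rw [h] at H1
    exact hc H1.symm
  have hH0 : PowerSeries.constantCoeff (H : PowerSeries (constants δ)) = 0 := by
    rw [← PowerSeries.coeff_zero_eq_constantCoeff_apply, coeff_coe, H0]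
  let _ : Invertible (PowerSeries.coeff 1 (H : PowerSeries (constants δ))) :=
    invertibleOfNonzero hH1
  set τ := PowerSeries.substInv (H : PowerSeries (constants δ))
  have hHτ : aeval τ H = PowerSeries.X := by
    rw [← PowerSeries.subst_coe (PowerSeries.HasSubst.substInv _),
      PowerSeries.subst_substInv_right _ hH0]
  have hτ0 : PowerSeries.constantCoeff τ = 0 := PowerSeries.constantCoeff_substInv _
  let π := Ideal.Quotient.mk (CentralAdic.principal (centralN δ z))
  let τ' := PowerSeries.map (π.comp (constF δ)) τ
  -- The coefficients of `τ` are constants of `δ`, hence central; this makes the evaluation `t ↦ τ'`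
  -- multiplicative.
  have hcomm : ∀ P, Commute ((PowerSeries.C.comp π) P) τ' := fun P => by
    ext n
    rw [RingHom.comp_apply, PowerSeries.coeff_C_mul, PowerSeries.coeff_mul_C,
      PowerSeries.coeff_map, RingHom.comp_apply, ← map_mul, ← map_mul]
    exact congr_arg π (Subring.mem_center_iff.1 (const_mem_center (PowerSeries.coeff n τ)) P)
  let ψ := (eval₂RingHom' (PowerSeries.C.comp π) τ' hcomm).comp (deform δ c)
  have hψK : ∀ a, ψ (const δ a) = PowerSeries.C (π (const δ a)) := fun a => by
    change eval₂ _ _ (deform δ c (const δ a)) = _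
    rw [deform_const, eval₂_C]
    rfl
  refine ⟨ψ, hψK, ?_, ?_⟩
  · have h1 : ψ (ofPoly δ (minAnn δ)) =
        PowerSeries.C (π (ofPoly δ (minAnn δ))) + PowerSeries.X := by
      change eval₂ _ _ (deform δ c (ofPoly δ (minAnn δ))) = _
      rw [hH, eval₂_add, eval₂_C, eval₂_map]
      congr 1
      -- Transporting `H(τ) = T` to the quotient ring shows that `H(t)` becomes `T`.
      have h2 := congr_arg (PowerSeries.map (π.comp (constF δ))) hHτ
      rw [PowerSeries.map_X, aeval_def, hom_eval₂] at h2
      rw [← h2]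
      congr 1
      ext a
      simp
    have hN : (centralN δ z : OrePoly δ) = ofPoly δ (minAnn δ) - const δ z := rfl
    have h3 : π (centralN δ z : OrePoly δ) = 0 :=
      Ideal.Quotient.eq_zero_iff_mem.2 ⟨1, (mul_one _).symm⟩
    rw [hN, map_sub] at h3
    rw [hN, map_sub, h1, hψK, add_sub_right_comm, ← map_sub, h3, map_zero, zero_add]
  · refine DFunLike.congr_fun (f := PowerSeries.constantCoeff.comp ψ) (g := π)
      (ringHom_ext (fun a => ?_) ?_)
    · rw [RingHom.comp_apply, hψK, PowerSeries.constantCoeff_C]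
    · have h1 : ψ (var δ) = PowerSeries.C (π (var δ)) + PowerSeries.C (π (const δ c)) * τ' := by
        change eval₂ _ _ (deform δ c (var δ)) = _
        rw [deform_var, eval₂_add, eval₂_C, eval₂_mul_noncomm _ _ fun k => hcomm _, eval₂_C,
          eval₂_X]
        rfl
      have h2 : PowerSeries.constantCoeff τ' = 0 := by
        rw [← PowerSeries.coeff_zero_eq_constantCoeff_apply, PowerSeries.coeff_map,
          PowerSeries.coeff_zero_eq_constantCoeff_apply, hτ0, map_zero]
      rw [RingHom.comp_apply, h1, map_add, map_mul, h2, mul_zero, add_zero,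
        PowerSeries.constantCoeff_C]

end

end DiffOre

theorem mainTheorem8 {K : Type*} [Field K] (δ : Derivation ℤ K K)
    [FiniteDimensional (DiffOre.constants δ) K] (z : DiffOre.constants δ) :
    ∃ φ : CentralAdic.limit (DiffOre.centralN δ z) ≃+*
        PowerSeries (DiffOre.OrePoly δ ⧸ CentralAdic.principal (DiffOre.centralN δ z)),
      -- `φ` is a morphism of `K`-algebras
      (∀ a : K, φ (CentralAdic.toLimit (DiffOre.centralN δ z) (DiffOre.const δ a)) =
        PowerSeries.C (Ideal.Quotient.mk (CentralAdic.principal (DiffOre.centralN δ z))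
          (DiffOre.const δ a))) ∧
      -- `φ` sends `N` to `T`
      φ (CentralAdic.toLimit (DiffOre.centralN δ z) (DiffOre.centralN δ z : DiffOre.OrePoly δ)) =
        PowerSeries.X ∧
      -- `φ` is the identity of `A⁺ / N A⁺` modulo `N` and `T`
      ∀ f : CentralAdic.limit (DiffOre.centralN δ z),
        PowerSeries.constantCoeff (φ f) = CentralAdic.reduction (DiffOre.centralN δ z) f := by
  obtain ⟨ψ, hK, hN, h0⟩ := DiffOre.exists_powerSeries_hom δ z
  obtain ⟨φ, hφ, hred⟩ := CentralAdic.exists_limit_equiv hN h0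
  exact ⟨φ, fun a => (hφ _).trans (hK a), (hφ _).trans hN, hred⟩
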